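/- Let $\alpha>0$ with $\alpha\neq 1$, $L\in\mathbb{R}$ and $a\in(0,1/2)$. There is a constant $K>0$, depending only on $\alpha$, $L$ and $a$, such that the following holds. Let $(\mathcal{X},\mathcal{A},P)$ be a probability space and let $\mathscr{C}\subset\mathcal{A}$ be a countable class of measurable sets such that $$\log \mathcal{N}_I(\epsilon,\mathscr{C},P)\le L\epsilon^{-\alpha}\qquad\text{for all }\epsilon>0,$$ where $\mathcal{N}_I(\epsilon,\mathscr{C},P)$ is the least number of brackets $[\ell,u]=\{f:\ell\le f\le u\}$ with $\ell,u\in L_1(P)$ and $\|u-\ell\|_{L_1(P)}<\epsilon$ needed to cover the set of indicators $\{\mathbf{1}_C: C\in\mathscr{C}\}$. For $C\in\mathscr{C}$ put $f_C=2\cdot\mathbf{1}_C-1$. Let $n\ge 1$ and, for $C_0\in\mathscr{C}$, let $\mathbb{E}_{C_0}$ be the expectation when one observes i.i.d. pairs $(X_1,Y_1),\dots,(X_n,Y_n)$ from the edge estimation ("black and white picture") model $$Y_i=f_{C_0}(X_i)\,\eta_i,\qquad X_i\sim P,\quad \mathbb{P}(\eta_i=1)=\tfrac12+a,\quad \mathbb{P}(\eta_i=-1)=\tfrac12-a,$$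 with $\eta_i$ independent of $X_i$. Then every (measurable) least squares estimator $$\widehat{C}_n\in\operatorname*{arg\,min}_{C\in\mathscr{C}}\sum_{i=1}^n\big(Y_i-2a f_C(X_i)\big)^2$$ over the whole class $\mathscr{C}$ satisfies $$\sup_{C_0\in\mathscr{C}}\mathbb{E}_{C_0}\,P\big(\widehat{C}_n\,\Delta\, C_0\big)\le K\,n^{-1/(\alpha+1)}.$$ -/

import Mathlib

open MeasureTheory
open scoped ENNReal symmDiff

universe u

noncomputable section

/-- The bracketing number of a class `F` of real functions under the norm of `L_p(P)`: the least
number of brackets `[ℓ, u] = {f : ℓ ≤ f ≤ u}` with end points in `L_p(P)` (not necessarily in `F`)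
and `‖u - ℓ‖_{L_p(P)} < ε` that cover `F`; it is `⊤` if no finite number suffices. -/
def bracketingNumber {𝒳 : Type u} [MeasurableSpace 𝒳] (ε : ℝ) (F : Set (𝒳 → ℝ)) (p : ℝ≥0∞)
    (P : Measure 𝒳) : ℕ∞ :=
  ⨅ (k : ℕ) (_ : ∃ l u : Fin k → 𝒳 → ℝ,
      (∀ j, MemLp (l j) p P ∧ MemLp (u j) p P ∧ eLpNorm (u j - l j) p P < ENNReal.ofReal ε) ∧
      ∀ f ∈ F, ∃ j, l j ≤ f ∧ f ≤ u j), (k : ℕ∞)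

/-- The bracketing number `N_I(ε, 𝒞, P)` of a class of sets: the `L_1(P)` bracketing number of the
class of indicator functions `1_C`, `C ∈ 𝒞`. -/
def setBracketingNumber {𝒳 : Type u} [MeasurableSpace 𝒳] (ε : ℝ) (𝒞 : Set (Set 𝒳))
    (P : Measure 𝒳) : ℕ∞ :=
  bracketingNumber ε ((fun C : Set 𝒳 => C.indicator (fun _ => (1 : ℝ))) '' 𝒞) 1 P

/-- The picture function `f_C = 2 · 1_C - 1`, equal to `1` on `C` (black) and `-1` off `C`
(white). -/
def pictureFun {𝒳 : Type u} (C : Set 𝒳) (x : 𝒳) : ℝ :=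
  2 * C.indicator (fun _ => (1 : ℝ)) x - 1

/-- The law of the flip noise: `η = 1` with probability `1/2 + a` and `η = -1` with probability
`1/2 - a`. -/
def flipNoise (a : ℝ) : Measure ℝ :=
  ENNReal.ofReal (1 / 2 + a) • Measure.dirac 1 + ENNReal.ofReal (1 / 2 - a) • Measure.dirac (-1)

/-- The joint law of `n` i.i.d. observations `(X_i, Y_i)` with `Y_i = f_{C₀}(X_i) η_i`, where
`X_i` has law `P` and `η_i` is flip noise independent of `X_i`. -/
def edgeLaw {𝒳 : Type u} [MeasurableSpace 𝒳] (P : Measure 𝒳) (a : ℝ) (C₀ : Set 𝒳) (n : ℕ) :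
    Measure (Fin n → 𝒳 × ℝ) :=
  Measure.pi fun _ =>
    (P.prod (flipNoise a)).map fun xe : 𝒳 × ℝ => (xe.1, pictureFun C₀ xe.1 * xe.2)

/-- The least squares criterion `∑ i, (Y_i - 2 a f_C(X_i))²` at the data `z = (X_i, Y_i)_i`. -/
def lsCriterion {𝒳 : Type u} (a : ℝ) {n : ℕ} (z : Fin n → 𝒳 × ℝ) (C : Set 𝒳) : ℝ :=
  ∑ i, ((z i).2 - 2 * a * pictureFun C (z i).1) ^ 2

/-- `Chat` is a least squares estimator over the whole class `𝒞`: at all data its value is a member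
of `𝒞` that minimizes the least squares criterion over `𝒞`. -/
def IsLeastSquaresEstimator {𝒳 : Type u} (a : ℝ) (𝒞 : Set (Set 𝒳)) {n : ℕ}
    (Chat : (Fin n → 𝒳 × ℝ) → Set 𝒳) : Prop :=
  ∀ z, Chat z ∈ 𝒞 ∧ ∀ C ∈ 𝒞, lsCriterion a z (Chat z) ≤ lsCriterion a z C

end

/-! A single bracketing scale suffices, without chaining, because `a > 0` keeps the noise away from
a fair coin. Since `f_C ^ 2 = 1`, a least squares set `C` has nonpositive total signed loss `∑ Y_i
f_{C₀}(X_i) 1_{C ∆ C₀}(X_i)`. With brackets of size `r`, this loss dominates one of `k ≤ exp (B n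
r)` functions `lowerLoss`, one per bracket and not depending on `C`. Its exponential moment decays
like `exp (-2 a² n q)`, where `q` is the mass of `C ∆ C₀` off the bracket's gap
(`lintegral_exp_sum_lowerLoss_le`). Summing over brackets gives risk `O(r)`
(`lintegral_measure_symmDiff_le`); `r = n ^ (-1 / (α + 1))` balances entropy `r ^ (-α)` against `n
r`. -/

/-- Indicators sharing a bracket can differ only where its width is at least 1, a set of mass at
most `ε` by Markov. Centres are taken in `𝒞`, so they are measurable when its members are. -/
theorem exists_finite_net_of_log_setBracketingNumber_le {𝒳 : Type u} [MeasurableSpace 𝒳]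
    {P : Measure 𝒳} {𝒞 : Set (Set 𝒳)} {C₀ : Set 𝒳} (hC₀ : C₀ ∈ 𝒞) {ε B : ℝ}
    (h : ENNReal.log (setBracketingNumber ε 𝒞 P : ℝ≥0∞) ≤ (B : EReal)) :
    ∃ (k : ℕ) (N W : Fin k → Set 𝒳), (k : ℝ) ≤ Real.exp B ∧
      (∀ j, N j ∈ 𝒞 ∧ MeasurableSet (W j) ∧ P (W j) ≤ ENNReal.ofReal ε) ∧
      ∀ C ∈ 𝒞, ∃ j, C ∆ N j ⊆ W j := by
  have hexp : (setBracketingNumber ε 𝒞 P : ℝ≥0∞) ≤ ENNReal.ofReal (Real.exp B) := by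
    have := EReal.exp_monotone h
    rwa [ENNReal.exp_log, EReal.exp_coe] at this
  -- Finiteness lets a strict inequality extract a cover attaining the infimum.
  have hlt : setBracketingNumber ε 𝒞 P < setBracketingNumber ε 𝒞 P + 1 := by
    have hne : setBracketingNumber ε 𝒞 P ≠ ⊤ := by
      intro htop
      rw [htop] at hexp
      exact absurd hexp (by simp)
    exact ENat.lt_add_one_iff hne |>.2 le_rfl
  have hlt' := hlt
  conv_lhs at hlt' => rw [setBracketingNumber, bracketingNumber]
  simp only [iInf_lt_iff] at hlt'
  obtain ⟨k, ⟨l, w, hlw, hcov⟩, hk⟩ := hlt'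
  have hk' : (k : ℕ∞) ≤ setBracketingNumber ε 𝒞 P := Order.le_of_lt_add_one hk
  have hkB : (k : ℝ) ≤ Real.exp B := by
    have h1 : ((k : ℕ∞) : ℝ≥0∞) ≤ ENNReal.ofReal (Real.exp B) :=
      le_trans (by exact_mod_cast hk') hexp
    rw [ENat.toENNReal_coe, ← ENNReal.ofReal_natCast] at h1
    exact (ENNReal.ofReal_le_ofReal_iff (Real.exp_pos B).le).1 h1
  let ind : Set 𝒳 → 𝒳 → ℝ := fun C => C.indicator (fun _ => (1 : ℝ))
  have hrep : ∀ j, ∃ C' ∈ 𝒞, (∃ C ∈ 𝒞, l j ≤ ind C ∧ ind C ≤ w j) →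
      l j ≤ ind C' ∧ ind C' ≤ w j := by
    intro j
    by_cases hj : ∃ C ∈ 𝒞, l j ≤ ind C ∧ ind C ≤ w j
    · obtain ⟨C, hC, hb⟩ := hj
      exact ⟨C, hC, fun _ => hb⟩
    -- Default centre for a bracket that contains no indicator from `𝒞`.
    · exact ⟨C₀, hC₀, fun hj' => absurd hj' hj⟩
  choose N hN hNb using hrep
  -- Bracket ends are only a.e. strongly measurable, hence the measurable hull.
  refine ⟨k, N, fun j => toMeasurable P {x | 1 ≤ ‖(w j - l j) x‖ₑ}, hkB, fun j =>
    ⟨hN j, measurableSet_toMeasurable _ _, ?_⟩, ?_⟩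
  · rw [measure_toMeasurable]
    obtain ⟨hl, hw, hε⟩ := hlw j
    have := mul_meas_ge_le_lintegral₀ (hw.sub hl).aestronglyMeasurable.enorm 1
    rw [one_mul, ← eLpNorm_one_eq_lintegral_enorm] at this
    exact this.trans hε.le
  · intro C hC
    obtain ⟨j, hlj, hwj⟩ := hcov (ind C) ⟨C, hC, rfl⟩
    refine ⟨j, fun x hx => subset_toMeasurable _ _ ?_⟩
    obtain ⟨hl', hw'⟩ := hNb j ⟨C, hC, hlj, hwj⟩
    have h1 := hlj x
    have h2 := hwj x
    have h3 := hl' x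
    have h4 := hw' x
    have h5 : 1 ≤ (w j - l j) x := by
      simp only [ind, Pi.sub_apply] at *
      rcases hx with ⟨hx, hx'⟩ | ⟨hx, hx'⟩ <;>
        simp only [Set.indicator_of_mem hx, Set.indicator_of_notMem hx'] at * <;> linarith
    have h6 : (1 : ℝ) ≤ ‖(w j - l j) x‖ := h5.trans (le_abs_self _)
    rw [Set.mem_ofPred_eq, ← ofReal_norm]
    exact ENNReal.one_le_ofReal.2 h6

/-! ### Signed loss and its lower bound over a bracket -/

theorem pictureFun_of_mem {𝒳 : Type u} {C : Set 𝒳} {x : 𝒳} (h : x ∈ C) : pictureFun C x = 1 := by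
  norm_num [pictureFun, h]

theorem pictureFun_of_notMem {𝒳 : Type u} {C : Set 𝒳} {x : 𝒳} (h : x ∉ C) :
    pictureFun C x = -1 := by
  norm_num [pictureFun, h]

theorem pictureFun_eq_or {𝒳 : Type u} (C : Set 𝒳) (x : 𝒳) :
    pictureFun C x = 1 ∨ pictureFun C x = -1 := by
  by_cases h : x ∈ C
  · exact .inl (pictureFun_of_mem h)
  · exact .inr (pictureFun_of_notMem h)

theorem measurable_pictureFun {𝒳 : Type u} [MeasurableSpace 𝒳] {C : Set 𝒳}
    (hC : MeasurableSet C) : Measurable (pictureFun C) :=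
  ((measurable_const.indicator hC).const_mul 2).sub_const 1

theorem isProbabilityMeasure_flipNoise {a : ℝ} (ha : 0 < a) (ha' : a < 1 / 2) :
    IsProbabilityMeasure (flipNoise a) := by
  constructor
  simp only [flipNoise, Measure.coe_add, Measure.coe_smul, Pi.add_apply, Pi.smul_apply,
    measure_univ, smul_eq_mul, mul_one]
  rw [← ENNReal.ofReal_add (by linarith) (by linarith)]
  norm_num

/-- A lower bound, valid for all `C` with `C ∆ N ⊆ W`, for the signed loss
`y f_{C₀}(x) 1_{C ∆ C₀}(x)`. -/
noncomputable def lowerLoss {𝒳 : Type u} (C₀ N W : Set 𝒳) (z : 𝒳 × ℝ) : ℝ :=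
  ((N ∆ C₀) \ W).indicator (fun _ => (1 : ℝ)) z.1 * (pictureFun C₀ z.1 * z.2) -
    W.indicator (fun _ => (1 : ℝ)) z.1 * |z.2|

theorem measurable_lowerLoss {𝒳 : Type u} [MeasurableSpace 𝒳] {C₀ N W : Set 𝒳}
    (hC₀ : MeasurableSet C₀) (hN : MeasurableSet N) (hW : MeasurableSet W) :
    Measurable (lowerLoss C₀ N W) := by
  have h1 : Measurable (((N ∆ C₀) \ W).indicator (fun _ => (1 : ℝ))) :=
    measurable_const.indicator ((hN.symmDiff hC₀).diff hW)
  have h2 : Measurable (W.indicator (fun _ => (1 : ℝ))) := measurable_const.indicator hW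
  have h3 := measurable_pictureFun hC₀
  exact ((h1.comp measurable_fst).mul ((h3.comp measurable_fst).mul measurable_snd)).sub
    ((h2.comp measurable_fst).mul measurable_snd.abs)

theorem lowerLoss_le {𝒳 : Type u} {C C₀ N W : Set 𝒳} (h : C ∆ N ⊆ W) (z : 𝒳 × ℝ) :
    lowerLoss C₀ N W z ≤ z.2 * (pictureFun C₀ z.1 - pictureFun C z.1) / 2 := by
  obtain ⟨x, y⟩ := z
  have h1 := neg_abs_le y
  have h2 := le_abs_self y
  have hCN : x ∉ W → (x ∈ C ↔ x ∈ N) := by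
    intro hx
    have := fun h' => hx (h h')
    rw [Set.mem_symmDiff] at this
    tauto
  by_cases hW : x ∈ W
  · rcases pictureFun_eq_or C₀ x with h3 | h3 <;> rcases pictureFun_eq_or C x with h4 | h4 <;>
      simp only [lowerLoss, hW, h3, h4, Set.indicator, Set.mem_sdiff, not_true, and_false, if_true,
        if_false] <;> linarith
  · by_cases hN : x ∈ N <;> by_cases h0 : x ∈ C₀ <;>
      norm_num [lowerLoss, pictureFun, Set.indicator, Set.mem_symmDiff, hCN hW, hW, hN, h0]
    linarith

/-- The quadratic terms cancel, so the criterion difference is `8 a` times the total signed loss. -/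
theorem sum_lowerLoss_nonpos {𝒳 : Type u} {a : ℝ} (ha : 0 < a) {n : ℕ} {C C₀ N W : Set 𝒳}
    (h : C ∆ N ⊆ W) {z : Fin n → 𝒳 × ℝ} (hls : lsCriterion a z C ≤ lsCriterion a z C₀) :
    ∑ i, lowerLoss C₀ N W (z i) ≤ 0 := by
  have hsq : ∀ (D : Set 𝒳) (x : 𝒳), pictureFun D x ^ 2 = 1 := by
    intro D x
    rcases pictureFun_eq_or D x with h | h <;> norm_num [h]
  have key : lsCriterion a z C - lsCriterion a z C₀ =
      8 * a * ∑ i, (z i).2 * (pictureFun C₀ (z i).1 - pictureFun C (z i).1) / 2 := by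
    rw [lsCriterion, lsCriterion, ← Finset.sum_sub_distrib, Finset.mul_sum]
    refine Finset.sum_congr rfl fun i _ => ?_
    linear_combination 4 * a ^ 2 * (hsq C (z i).1 - hsq C₀ (z i).1)
  refine (Finset.sum_le_sum fun i _ => lowerLoss_le h (z i)).trans ?_
  by_contra hpos
  have := mul_pos (mul_pos (by norm_num : (0 : ℝ) < 8) ha) (not_le.1 hpos)
  linarith

/-! ### Exponential moments -/

/-- Chernoff bound for one observation, at the inverse temperature `-log (1 - 2 a)`. -/
theorem lintegral_exp_lowerLoss_le {𝒳 : Type u} [MeasurableSpace 𝒳] {P : Measure 𝒳}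
    [IsProbabilityMeasure P] {a : ℝ} (ha : 0 < a) (ha' : a < 1 / 2) {C₀ N W : Set 𝒳}
    (hC₀ : MeasurableSet C₀) (hN : MeasurableSet N) (hW : MeasurableSet W) {r : ℝ}
    (hr : P.real W ≤ r) :
    ∫⁻ z, ENNReal.ofReal (Real.exp (Real.log (1 - 2 * a) * lowerLoss C₀ N W z))
        ∂((P.prod (flipNoise a)).map fun xe : 𝒳 × ℝ => (xe.1, pictureFun C₀ xe.1 * xe.2)) ≤
      ENNReal.ofReal (Real.exp
        ((1 - 2 * a)⁻¹ * r - 2 * a ^ 2 * P.real ((N ∆ C₀) \ W))) := by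
  have := isProbabilityMeasure_flipNoise ha ha'
  have hb : 0 < 1 - 2 * a := by linarith
  have hb1 : 1 ≤ (1 - 2 * a)⁻¹ := (one_le_inv₀ hb).2 (by linarith)
  have hD : MeasurableSet ((N ∆ C₀) \ W) := (hN.symmDiff hC₀).diff hW
  set D := (N ∆ C₀) \ W with hDdef
  have hΦ : Measurable fun z => ENNReal.ofReal
      (Real.exp (Real.log (1 - 2 * a) * lowerLoss C₀ N W z)) :=
    (((measurable_lowerLoss hC₀ hN hW).const_mul _).exp).ennreal_ofReal
  have hmap : Measurable fun xe : 𝒳 × ℝ => (xe.1, pictureFun C₀ xe.1 * xe.2) :=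
    measurable_fst.prodMk
      (((measurable_pictureFun hC₀).comp measurable_fst).mul measurable_snd)
  rw [lintegral_map hΦ hmap, lintegral_prod _
    (show AEMeasurable (fun xe : 𝒳 × ℝ => ENNReal.ofReal
      (Real.exp (Real.log (1 - 2 * a) * lowerLoss C₀ N W (xe.1, pictureFun C₀ xe.1 * xe.2)))) _
      from (hΦ.comp hmap).aemeasurable)]
  let g : 𝒳 → ℝ := fun x => 1 + (1 - 2 * a)⁻¹ * W.indicator (fun _ => (1 : ℝ)) x -
    2 * a ^ 2 * D.indicator (fun _ => (1 : ℝ)) x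
  have hg0 : ∀ x, 0 ≤ g x := by
    intro x
    have h2 : 2 * a ^ 2 ≤ 1 := by nlinarith
    have h1 : 0 ≤ W.indicator (fun _ => (1 : ℝ)) x := Set.indicator_nonneg (fun _ _ => zero_le_one) x
    have h3 : D.indicator (fun _ => (1 : ℝ)) x ≤ 1 := Set.indicator_le_self' (by simp) x
    have h4 := mul_nonneg (zero_le_one.trans hb1) h1
    have h5 : 2 * a ^ 2 * D.indicator (fun _ => (1 : ℝ)) x ≤ 2 * a ^ 2 :=
      mul_le_of_le_one_right (by positivity) h3
    simp only [g]
    linarith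
  have hpt : ∀ x, ∫⁻ e, ENNReal.ofReal (Real.exp (Real.log (1 - 2 * a) *
      lowerLoss C₀ N W (x, pictureFun C₀ x * e))) ∂(flipNoise a) ≤ ENNReal.ofReal (g x) := by
    intro x
    rw [flipNoise, lintegral_add_measure, lintegral_smul_measure, lintegral_smul_measure,
      lintegral_dirac, lintegral_dirac, smul_eq_mul, smul_eq_mul,
      ← ENNReal.ofReal_mul (by linarith), ← ENNReal.ofReal_mul (by linarith),
      ← ENNReal.ofReal_add (by positivity) (mul_nonneg (by linarith) (Real.exp_pos _).le)]
    refine ENNReal.ofReal_le_ofReal ?_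
    have hexp : Real.exp (Real.log (1 - 2 * a)) = 1 - 2 * a := Real.exp_log hb
    have hexp' : Real.exp (-Real.log (1 - 2 * a)) = (1 - 2 * a)⁻¹ := by rw [Real.exp_neg, hexp]
    have habs : |pictureFun C₀ x| = 1 := by
      rcases pictureFun_eq_or C₀ x with h | h <;> norm_num [h]
    have hsq : pictureFun C₀ x * pictureFun C₀ x = 1 := by
      rcases pictureFun_eq_or C₀ x with h | h <;> norm_num [h]
    have hval : ∀ e : ℝ, |e| = 1 → lowerLoss C₀ N W (x, pictureFun C₀ x * e) =
        D.indicator (fun _ => (1 : ℝ)) x * e - W.indicator (fun _ => (1 : ℝ)) x := by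
      intro e he
      simp only [lowerLoss, ← mul_assoc (pictureFun C₀ x), hsq, abs_mul, habs, he, ← hDdef]
      ring
    rw [hval 1 (by norm_num), hval (-1) (by norm_num)]
    simp only [g]
    by_cases hxW : x ∈ W
    · have hxD : x ∉ D := fun h => h.2 hxW
      simp only [hxW, hxD, Set.indicator_of_mem, Set.indicator_of_notMem, not_false_eq_true,
        neg_zero, zero_sub, mul_neg, mul_one, hexp', mul_zero]
      linarith
    · by_cases hxD : x ∈ D
      · simp only [hxW, hxD, Set.indicator_of_mem, Set.indicator_of_notMem, not_false_eq_true,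
          sub_zero, mul_neg, mul_one, hexp, hexp', mul_zero, add_zero]
        -- This temperature makes the moment on `D` exactly `(1/2 - 2 a²) + 1/2 = 1 - 2 a²`.
        have : (1 / 2 - a) * (1 - 2 * a)⁻¹ = 1 / 2 := by
          field_simp
        rw [this]
        nlinarith
      · simp only [hxW, hxD, Set.indicator_of_notMem, not_false_eq_true, zero_mul, sub_zero,
          mul_zero, Real.exp_zero, add_zero]
        linarith
  refine (lintegral_mono hpt).trans ?_
  have hiW : Integrable (fun x => (1 - 2 * a)⁻¹ * W.indicator (fun _ => (1 : ℝ)) x) P :=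
    ((integrable_const 1).indicator hW).const_mul _
  have hiD : Integrable (fun x => 2 * a ^ 2 * D.indicator (fun _ => (1 : ℝ)) x) P :=
    ((integrable_const 1).indicator hD).const_mul _
  have hi1 : Integrable (fun x => 1 + (1 - 2 * a)⁻¹ * W.indicator (fun _ => (1 : ℝ)) x) P :=
    (integrable_const 1).add hiW
  rw [← ofReal_integral_eq_lintegral_ofReal (f := g) (hi1.sub hiD) (.of_forall hg0)]
  refine ENNReal.ofReal_le_ofReal ?_
  have hint : ∫ x, g x ∂P = 1 + (1 - 2 * a)⁻¹ * P.real W - 2 * a ^ 2 * P.real D := by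
    simp only [g]
    rw [integral_sub hi1 hiD, integral_add (integrable_const 1) hiW, integral_const_mul,
      integral_const_mul, integral_indicator_const _ hW, integral_indicator_const _ hD]
    simp
  rw [hint]
  have h1 := mul_le_mul_of_nonneg_left hr (zero_le_one.trans hb1)
  have h2 := Real.add_one_le_exp ((1 - 2 * a)⁻¹ * r - 2 * a ^ 2 * P.real D)
  linarith

theorem lintegral_prod_pi_const {E : Type*} [MeasurableSpace E] (μ : Measure E)
    [IsProbabilityMeasure μ] {f : E → ℝ≥0∞} (hf : Measurable f) (n : ℕ) :
    ∫⁻ z : Fin n → E, ∏ i, f (z i) ∂(Measure.pi fun _ => μ) = (∫⁻ x, f x ∂μ) ^ n := by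
  have hind := ProbabilityTheory.iIndepFun_pi (μ := fun _ : Fin n => μ) (X := fun _ => f)
    fun _ => hf.aemeasurable
  rw [ProbabilityTheory.lintegral_prod_eq_prod_lintegral_of_indepFun Finset.univ _ hind
    fun i => hf.comp (measurable_pi_apply i)]
  simp [(measurePreserving_eval (fun _ : Fin n => μ) _).lintegral_comp hf]

theorem lintegral_exp_sum_lowerLoss_le {𝒳 : Type u} [MeasurableSpace 𝒳] {P : Measure 𝒳}
    [IsProbabilityMeasure P] {a : ℝ} (ha : 0 < a) (ha' : a < 1 / 2) {C₀ N W : Set 𝒳}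
    (hC₀ : MeasurableSet C₀) (hN : MeasurableSet N) (hW : MeasurableSet W) {r : ℝ}
    (hr : P.real W ≤ r) (n : ℕ) :
    ∫⁻ z, ENNReal.ofReal (Real.exp (Real.log (1 - 2 * a) * ∑ i, lowerLoss C₀ N W (z i)))
        ∂(edgeLaw P a C₀ n) ≤
      ENNReal.ofReal (Real.exp
        (n * ((1 - 2 * a)⁻¹ * r - 2 * a ^ 2 * P.real ((N ∆ C₀) \ W)))) := by
  have := isProbabilityMeasure_flipNoise ha ha'
  have hmap : Measurable fun xe : 𝒳 × ℝ => (xe.1, pictureFun C₀ xe.1 * xe.2) :=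
    measurable_fst.prodMk
      (((measurable_pictureFun hC₀).comp measurable_fst).mul measurable_snd)
  have := Measure.isProbabilityMeasure_map (μ := P.prod (flipNoise a)) hmap.aemeasurable
  have hΦ : Measurable fun z => ENNReal.ofReal
      (Real.exp (Real.log (1 - 2 * a) * lowerLoss C₀ N W z)) :=
    (((measurable_lowerLoss hC₀ hN hW).const_mul _).exp).ennreal_ofReal
  have hprod : ∀ z : Fin n → 𝒳 × ℝ,
      ENNReal.ofReal (Real.exp (Real.log (1 - 2 * a) * ∑ i, lowerLoss C₀ N W (z i))) =
        ∏ i, ENNReal.ofReal (Real.exp (Real.log (1 - 2 * a) * lowerLoss C₀ N W (z i))) := by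
    intro z
    rw [Finset.mul_sum, Real.exp_sum, ENNReal.ofReal_prod_of_nonneg fun i _ => (Real.exp_pos _).le]
  simp only [hprod, edgeLaw]
  rw [lintegral_prod_pi_const _ hΦ, Real.exp_nat_mul, ENNReal.ofReal_pow (Real.exp_pos _).le]
  exact pow_le_pow_left' (lintegral_exp_lowerLoss_le ha ha' hC₀ hN hW hr) n

/-! ### Risk bound and rate -/

/-- The expectation is bounded directly, without integrating tails: the loss is at most a constant
plus an exponential, and the selected bracket's weight `G j z ≥ 1` allows a sum over all brackets.
-/
theorem lintegral_measure_symmDiff_le {𝒳 : Type u} [MeasurableSpace 𝒳] {P : Measure 𝒳}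
    [IsProbabilityMeasure P] {a : ℝ} (ha : 0 < a) (ha' : a < 1 / 2) {𝒞 : Set (Set 𝒳)}
    (h𝒞 : ∀ C ∈ 𝒞, MeasurableSet C) {C₀ : Set 𝒳} (hC₀ : C₀ ∈ 𝒞) {r B : ℝ} (hr : 0 < r)
    (hB : 0 ≤ B) {n : ℕ} (hn : 1 ≤ n) (hnr : 1 ≤ n * r)
    (h : ENNReal.log (setBracketingNumber r 𝒞 P : ℝ≥0∞) ≤ ((B * (n * r) : ℝ) : EReal))
    {Chat : (Fin n → 𝒳 × ℝ) → Set 𝒳} (hChat : IsLeastSquaresEstimator a 𝒞 Chat) :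
    ∫⁻ z, P (Chat z ∆ C₀) ∂(edgeLaw P a C₀ n) ≤
      ENNReal.ofReal ((B + (1 - 2 * a)⁻¹ + 2 * a ^ 2 + 1) / (2 * a ^ 2) * r) := by
  obtain ⟨k, N, W, hk, hNW, hcov⟩ := exists_finite_net_of_log_setBracketingNumber_le hC₀ h
  have := isProbabilityMeasure_flipNoise ha ha'
  have hmap : Measurable fun xe : 𝒳 × ℝ => (xe.1, pictureFun C₀ xe.1 * xe.2) :=
    measurable_fst.prodMk
      (((measurable_pictureFun (h𝒞 _ hC₀)).comp measurable_fst).mul measurable_snd)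
  have := Measure.isProbabilityMeasure_map (μ := P.prod (flipNoise a)) hmap.aemeasurable
  have : IsProbabilityMeasure (edgeLaw P a C₀ n) := by
    unfold edgeLaw
    infer_instance
  have hn0 : (0 : ℝ) < n := by exact_mod_cast hn
  have hb : 0 < 1 - 2 * a := by linarith
  have hlog : Real.log (1 - 2 * a) ≤ 0 := Real.log_nonpos hb.le (by linarith)
  have hPW : ∀ j, P.real (W j) ≤ r := fun j =>
    ENNReal.toReal_le_of_le_ofReal hr.le (hNW j).2.2
  -- Chosen so that in `hterm` the `q j` cancel and the exponent is `-B n r`, which offsets the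
  -- number of brackets.
  set M : ℝ := n * r * (B + (1 - 2 * a)⁻¹ + 2 * a ^ 2) with hM
  have hM0 : 0 ≤ M := by positivity
  have hc : 0 < n * (2 * a ^ 2) := by positivity
  let q : Fin k → ℝ := fun j => P.real ((N j ∆ C₀) \ W j)
  let G : Fin k → (Fin n → 𝒳 × ℝ) → ℝ≥0∞ := fun j z => ENNReal.ofReal
    (Real.exp (Real.log (1 - 2 * a) * ∑ i, lowerLoss C₀ (N j) (W j) (z i)))
  let c : Fin k → ℝ≥0∞ := fun j =>
    ENNReal.ofReal (Real.exp (n * (2 * a ^ 2) * (q j + r) - M) / (n * (2 * a ^ 2)))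
  have hG : ∀ j, Measurable (G j) := fun j =>
    ((Finset.measurable_sum _ fun i _ => (measurable_lowerLoss (h𝒞 _ hC₀) (h𝒞 _ (hNW j).1)
      (hNW j).2.1).comp (measurable_pi_apply i)).const_mul _).exp.ennreal_ofReal
  have hpt : ∀ z, P (Chat z ∆ C₀) ≤
      ENNReal.ofReal (M / (n * (2 * a ^ 2))) + ∑ j, c j * G j z := by
    intro z
    obtain ⟨hmem, hmin⟩ := hChat z
    obtain ⟨j, hj⟩ := hcov _ hmem
    have hG1 : 1 ≤ G j z := by
      refine ENNReal.one_le_ofReal.2 (Real.one_le_exp ?_)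
      exact mul_nonneg_of_nonpos_of_nonpos hlog (sum_lowerLoss_nonpos ha hj (hmin C₀ hC₀))
    have hsub : Chat z ∆ C₀ ⊆ ((N j ∆ C₀) \ W j) ∪ W j := by
      rw [Set.sdiff_union_self]
      intro x hx
      have hx' : x ∈ Chat z ∆ N j → x ∈ W j := fun h => hj h
      simp only [Set.mem_union, Set.mem_symmDiff] at *
      tauto
    have hp : P.real (Chat z ∆ C₀) ≤ q j + r :=
      (measureReal_mono hsub).trans ((measureReal_union_le _ _).trans (by
        simpa [q] using hPW j))
    have hreal : P.real (Chat z ∆ C₀) ≤ M / (n * (2 * a ^ 2)) +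
        Real.exp (n * (2 * a ^ 2) * (q j + r) - M) / (n * (2 * a ^ 2)) := by
      rw [← add_div, le_div_iff₀ hc]
      have h1 := Real.add_one_le_exp (n * (2 * a ^ 2) * (q j + r) - M)
      have h2 := mul_le_mul_of_nonneg_left hp hc.le
      linarith
    calc P (Chat z ∆ C₀) = ENNReal.ofReal (P.real (Chat z ∆ C₀)) :=
          (ofReal_measureReal (measure_ne_top _ _)).symm
      _ ≤ ENNReal.ofReal (M / (n * (2 * a ^ 2))) + c j := by
          rw [← ENNReal.ofReal_add (by positivity) (by positivity)]
          exact ENNReal.ofReal_le_ofReal hreal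
      _ ≤ ENNReal.ofReal (M / (n * (2 * a ^ 2))) + c j * G j z := by
          gcongr
          exact le_mul_of_one_le_right' hG1
      _ ≤ _ := by
          gcongr
          exact Finset.single_le_sum (f := fun j => c j * G j z) (fun _ _ => zero_le)
            (Finset.mem_univ j)
  have hterm : ∀ j, c j * ∫⁻ z, G j z ∂(edgeLaw P a C₀ n) ≤
      ENNReal.ofReal (Real.exp (-(B * (n * r))) / (n * (2 * a ^ 2))) := by
    intro j
    refine (mul_le_mul_right (lintegral_exp_sum_lowerLoss_le ha ha' (h𝒞 _ hC₀)
      (h𝒞 _ (hNW j).1) (hNW j).2.1 (hPW j) n) _).trans ?_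
    rw [← ENNReal.ofReal_mul (by positivity), div_mul_eq_mul_div, ← Real.exp_add]
    refine le_of_eq ?_
    congr 3
    simp only [hM, q]
    ring
  calc ∫⁻ z, P (Chat z ∆ C₀) ∂(edgeLaw P a C₀ n)
      ≤ ∫⁻ z, (ENNReal.ofReal (M / (n * (2 * a ^ 2))) + ∑ j, c j * G j z)
          ∂(edgeLaw P a C₀ n) := lintegral_mono hpt
    _ = ENNReal.ofReal (M / (n * (2 * a ^ 2))) +
          ∑ j, c j * ∫⁻ z, G j z ∂(edgeLaw P a C₀ n) := by
        rw [lintegral_add_left measurable_const, lintegral_const, measure_univ, mul_one,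
          lintegral_finsetSum _ fun j _ => (hG j).const_mul _]
        congr 1
        exact Finset.sum_congr rfl fun j _ => lintegral_const_mul _ (hG j)
    _ ≤ ENNReal.ofReal (M / (n * (2 * a ^ 2))) +
          ∑ _j : Fin k, ENNReal.ofReal (Real.exp (-(B * (n * r))) / (n * (2 * a ^ 2))) := by
        gcongr with j
        exact hterm j
    _ = ENNReal.ofReal (M / (n * (2 * a ^ 2)) +
          k * (Real.exp (-(B * (n * r))) / (n * (2 * a ^ 2)))) := by
        rw [Finset.sum_const, Finset.card_univ, Fintype.card_fin, nsmul_eq_mul,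
          ← ENNReal.ofReal_natCast, ← ENNReal.ofReal_mul (by positivity),
          ← ENNReal.ofReal_add (by positivity) (by positivity)]
    _ ≤ _ := by
        refine ENNReal.ofReal_le_ofReal ?_
        have hk1 : k * Real.exp (-(B * (n * r))) ≤ 1 := by
          refine (mul_le_mul_of_nonneg_right hk (Real.exp_pos _).le).trans ?_
          rw [← Real.exp_add, add_neg_cancel, Real.exp_zero]
        rw [← mul_div_assoc, ← add_div, div_le_iff₀ hc]
        have : (B + (1 - 2 * a)⁻¹ + 2 * a ^ 2 + 1) / (2 * a ^ 2) * r * (n * (2 * a ^ 2)) =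
            M + n * r := by
          rw [hM]
          field_simp
        rw [this]
        -- The leftover 1 is absorbed by `1 ≤ n * r`.
        linarith

theorem theorem5 (α L a : ℝ) (hα : 0 < α) (hα1 : α ≠ 1) (ha : 0 < a) (ha' : a < 1 / 2) :
    ∃ K : ℝ, 0 < K ∧
      ∀ (𝒳 : Type u) [MeasurableSpace 𝒳] (P : Measure 𝒳) [IsProbabilityMeasure P]
        (𝒞 : Set (Set 𝒳)), 𝒞.Countable → (∀ C ∈ 𝒞, MeasurableSet C) →
        (∀ ε : ℝ, 0 < ε →
          ENNReal.log (setBracketingNumber ε 𝒞 P : ℝ≥0∞) ≤ ((L * ε ^ (-α) : ℝ) : EReal)) →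
        ∀ n : ℕ, 1 ≤ n →
        ∀ Chat : (Fin n → 𝒳 × ℝ) → Set 𝒳,
          IsLeastSquaresEstimator a 𝒞 Chat →
          (∀ C₀ ∈ 𝒞, Measurable fun z => P (Chat z ∆ C₀)) →
          ⨆ C₀ ∈ 𝒞, ∫⁻ z, P (Chat z ∆ C₀) ∂(edgeLaw P a C₀ n)
            ≤ ENNReal.ofReal (K * (n : ℝ) ^ (-1 / (α + 1))) := by
  have hb : 0 < 1 - 2 * a := by linarith
  refine ⟨(|L| + (1 - 2 * a)⁻¹ + 2 * a ^ 2 + 1) / (2 * a ^ 2), by positivity, ?_⟩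
  intro 𝒳 _ P _ 𝒞 _ h𝒞 hent n hn Chat hChat _
  refine iSup₂_le fun C₀ hC₀ => ?_
  have hn1 : (1 : ℝ) ≤ n := by exact_mod_cast hn
  have hn0 : (0 : ℝ) < n := by linarith
  have hα0 : α + 1 ≠ 0 := by linarith
  have hr : 0 < (n : ℝ) ^ (-1 / (α + 1)) := Real.rpow_pos_of_pos hn0 _
  have hnr : (n : ℝ) * (n : ℝ) ^ (-1 / (α + 1)) = (n : ℝ) ^ (α / (α + 1)) := by
    rw [← Real.rpow_one_add' hn0.le]
    · congr 1
      field_simp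
      ring
    · have : 1 + -1 / (α + 1) = α / (α + 1) := by
        field_simp
        ring
      rw [this]
      positivity
  refine lintegral_measure_symmDiff_le ha ha' h𝒞 hC₀ hr (abs_nonneg L) hn ?_ ?_ hChat
  · rw [hnr]
    exact Real.one_le_rpow hn1 (by positivity)
  · refine (hent _ hr).trans (EReal.coe_le_coe_iff.2 ?_)
    have : ((n : ℝ) ^ (-1 / (α + 1))) ^ (-α) = (n : ℝ) ^ (α / (α + 1)) := by
      rw [← Real.rpow_mul hn0.le]
      congr 1
      field_simp
    rw [hnr, this]
    exact mul_le_mul_of_nonneg_right (le_abs_self L) (by positivity)
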